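/- Let $n\ge 2$ and let $T_{4n}=\langle a,b\mid a^{2n}=1,\ a^n=b^2,\ b^{-1}ab=a^{-1}\rangle$ be the dicyclic group of order $4n$. Let $S\subseteq T_{4n}$ satisfy $1\notin S$, $S=S^{-1}$ and $gSg^{-1}=S$ for all $g\in T_{4n}$, and let $\mathrm{Cay}(T_{4n},S)$ be the graph with vertex set $T_{4n}$ and edges $\{g,sg\}$, $g\in T_{4n}$, $s\in S$. Let $A$ be its adjacency matrix and $H(t)=\exp(\mathrm{i}tA)$, $t\in\mathbb R$. For distinct vertices $u,v$, say that the graph admits pretty good fractional revival (PGFR) from $u$ to $v$ if there are a sequence $(t_k)$ of real numbers and $\alpha,\beta\in\mathbb C$ with $|\alpha|^2+|\beta|^2=1$, $\beta\neq 0$ and $\lim_{k\to\infty}H(t_k)\mathbf e_u=\alpha\mathbf e_u+\beta\mathbf e_v$. Put $\omega=\exp(\pi\mathrm{i}/n)$, and $\varepsilon=1$ if $n$ is even, $\varepsilon=\mathrm{i}$ if $n$ is odd. Let $\psi_1,\psi_2,\psi_3,\psi_4$ be the representations of $T_{4n}$ of degree one with $(\psi_i(a),\psi_i(b))=(1,1),(1,-1),(-1,\varepsilon),(-1,-\varepsilon)$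 respectively, and for $1\le h\le n-1$ let $\rho_h$ be the representation of degree two with $$\rho_h(a)=\begin{pmatrix}\omega^h&0\\0&\omega^{-h}\end{pmatrix},\qquad \rho_h(b)=\begin{pmatrix}0&1\\ \omega^{hn}&0\end{pmatrix}.$$ Let $\lambda_i=\sum_{s\in S}\psi_i(s)$ $(1\le i\le 4)$ and $\mu_h=\frac12\sum_{s\in S}\operatorname{Tr}\rho_h(s)$ $(1\le h\le n-1)$ be the corresponding eigenvalues of $\mathrm{Cay}(T_{4n},S)$. (a) If $\mathrm{Cay}(T_{4n},S)$ admits PGFR from $u$ to $v$, then $u$ and $v$ lie in the same coset of $\langle a\rangle$ and $v=ua^n$. (b) Let $n$ be odd and $v=ua^n$. Then $\mathrm{Cay}(T_{4n},S)$ admits PGFR from $u$ to $v$ if and only if, for all integers $l'_2,l'_3,l'_4,l_1,\dots,l_{n-1}$, $$\sum_{i=2}^4 l'_i(\lambda_i-\lambda_1)+\sum_{h=1}^{n-1}l_h(\mu_h-\lambda_1)=0\quad\text{implies}\quad l'_3+l'_4+\sum_{h\text{ odd}}l_h\neq\pm1 .$$ (c) Let $n$ be even and $v=ua^n$. Then $\mathrm{Cay}(T_{4n},S)$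 admits PGFR from $u$ to $v$ if and only if, for all integers $l'_2,l'_3,l'_4,l_1,\dots,l_{n-1}$, $$\sum_{i=2}^4 l'_i(\lambda_i-\lambda_1)+\sum_{h=1}^{n-1}l_h(\mu_h-\lambda_1)=0\quad\text{implies}\quad \sum_{h\text{ odd}}l_h\neq\pm1 .$$ Here $\sum_{h\text{ odd}}$ runs over the odd $h$ with $1\le h\le n-1$. -/

import Mathlib

open Filter Topology

/-! ### Continuous-time quantum walks on finite graphs -/

section QuantumWalk

variable {V : Type*} [Fintype V] [DecidableEq V]

/-- The transition matrix `H(t) = exp(i t A)` of a finite graph with adjacency matrix `A`. -/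
noncomputable def transitionMatrix (Γ : SimpleGraph V) [DecidableRel Γ.Adj] (t : ℝ) :
    Matrix V V ℂ :=
  NormedSpace.exp ((Complex.I * (t : ℂ)) • Γ.adjMatrix ℂ)

/-- Pretty good fractional revival from `u` to `v`: the vertices are distinct, and for some real
sequence `t_k` the vectors `H(t_k) e_u` converge to `α e_u + β e_v` with `|α|² + |β|² = 1`.
The case `β = 0` (approximate periodicity at `u`) is excluded. -/
def AdmitsPGFR (Γ : SimpleGraph V) [DecidableRel Γ.Adj] (u v : V) : Prop :=
  u ≠ v ∧ ∃ (t : ℕ → ℝ) (α β : ℂ), ‖α‖ ^ 2 + ‖β‖ ^ 2 = 1 ∧ β ≠ 0 ∧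
    Tendsto (fun k => (transitionMatrix Γ (t k)).mulVec (Pi.single u 1)) atTop
      (𝓝 (α • Pi.single u (1 : ℂ) + β • Pi.single v (1 : ℂ)))

end QuantumWalk

/-- The Cayley graph `Cay(G, S)` with edges `{g, sg}`, `g ∈ G`, `s ∈ S`. (It is used for
inverse-closed `S` with `1 ∉ S`.) -/
def cayleyGraph {G : Type*} [Group G] (S : Finset G) : SimpleGraph G :=
  SimpleGraph.fromRel (fun g g' => ∃ s ∈ S, g' = s * g)

instance cayleyGraph.decidableAdj {G : Type*} [Group G] [DecidableEq G] (S : Finset G) :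
    DecidableRel (cayleyGraph S).Adj :=
  fun g g' => decidable_of_iff
    (g ≠ g' ∧ ((∃ s ∈ S, g' = s * g) ∨ (∃ s ∈ S, g = s * g'))) Iff.rfl

/-- The eigenvalue `(1/d) ∑_{s ∈ S} χ_ρ(s)` of `Cay(G, S)` that corresponds to a
representation `ρ` of degree `d` with character `χ_ρ = tr ∘ ρ`. -/
noncomputable def cayleyEigenvalue {G : Type*} [Group G] {d : ℕ} (S : Finset G)
    (ρ : G →* Matrix (Fin d) (Fin d) ℂ) : ℂ :=
  (1 / (d : ℂ)) * ∑ s ∈ S, (ρ s).trace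

/-! ### The irreducible representations of the dicyclic group

The dicyclic group `T_{4n} = ⟨a, b | a^{2n} = 1, a^n = b², b⁻¹ab = a⁻¹⟩` is Mathlib's
`QuaternionGroup n`, with `a = QuaternionGroup.a 1`, `b = QuaternionGroup.xa 0`; its elements are
`QuaternionGroup.a k = a^k` and `QuaternionGroup.xa k = b a^k`. -/

namespace Dicyclic

section Generators

variable {M : Type*} [Monoid M] {n : ℕ} {A B : M}

theorem pow_val_natCast (h : A ^ (2 * n) = 1) (k : ℕ) :
    A ^ ((k : ZMod (2 * n)).val) = A ^ k := by
  rw [ZMod.val_natCast, ← pow_mod_orderOf, Nat.mod_mod_of_dvd _ (orderOf_dvd_of_pow_eq_one h),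
    pow_mod_orderOf]

theorem pow_val_add [NeZero n] (h : A ^ (2 * n) = 1) (i j : ZMod (2 * n)) :
    A ^ (i + j).val = A ^ i.val * A ^ j.val := by
  rw [← pow_add, ← pow_val_natCast h (i.val + j.val)]
  simp

theorem pow_mul_mul_pow (h : A * B * A = B) (k : ℕ) : A ^ k * B * A ^ k = B := by
  induction k with
  | zero => simp
  | succ k ih =>
    calc A ^ (k + 1) * B * A ^ (k + 1) = A ^ k * (A * B * A) * A ^ k := by
          rw [pow_succ]; nth_rewrite 2 [← pow_succ]; rw [pow_succ']; simp only [mul_assoc]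
      _ = B := by rw [h, ih]

theorem pow_val_mul [NeZero n] (h : A ^ (2 * n) = 1) (h' : A * B * A = B) (i j : ZMod (2 * n)) :
    A ^ i.val * B * A ^ j.val = B * A ^ (j - i).val := by
  have e : A ^ j.val = A ^ i.val * A ^ (j - i).val := by
    rw [← pow_val_add h]; simp
  rw [e, ← mul_assoc, pow_mul_mul_pow h']

/-- The homomorphism from the dicyclic group that maps the generators `a`, `b` to elements
`A`, `B` satisfying the defining relations. -/
def homOfGenerators [NeZero n] (A B : M) (h₁ : A ^ (2 * n) = 1) (h₂ : B * B = A ^ n) (h₃ : A * B * A = B) :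
    QuaternionGroup n →* M where
  toFun
    | QuaternionGroup.a k => A ^ k.val
    | QuaternionGroup.xa k => B * A ^ k.val
  map_one' := by
    rw [QuaternionGroup.one_def]; simp
  map_mul' := by
    rintro (i | i) (j | j)
    · exact pow_val_add h₁ i j
    · simp only [QuaternionGroup.a_mul_xa]
      rw [← mul_assoc, pow_val_mul h₁ h₃]
    · simp only [QuaternionGroup.xa_mul_a]
      rw [pow_val_add h₁, mul_assoc]
    · simp only [QuaternionGroup.xa_mul_xa]
      rw [mul_assoc, ← mul_assoc (A ^ i.val), pow_val_mul h₁ h₃, ← mul_assoc, h₂, add_sub_assoc,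
        pow_val_add h₁, pow_val_natCast h₁]

end Generators

variable (n : ℕ)

/-- `ω = exp(π i / n)`. -/
noncomputable def omega : ℂ := Complex.exp (Real.pi * Complex.I / n)

theorem omega_pow [NeZero n] : omega n ^ (2 * n) = 1 := by
  have hn : (n : ℂ) ≠ 0 := Nat.cast_ne_zero.mpr (NeZero.ne n)
  rw [omega, ← Complex.exp_nat_mul, Complex.exp_eq_one_iff]
  refine ⟨1, ?_⟩
  push_cast
  field_simp

theorem omega_ne_zero : omega n ≠ 0 := Complex.exp_ne_zero _

/-- `ε = 1` for even `n`, and `ε = i` for odd `n`. -/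
noncomputable def eps : ℂ := if Even n then 1 else Complex.I

theorem eps_mul_eps : eps n * eps n = (-1) ^ n := by
  unfold eps
  split_ifs with h
  · simp [h.neg_one_pow]
  · simp [(Nat.not_even_iff_odd.mp h).neg_one_pow]

/-- `∑_{h odd} l_h` over `1 ≤ h ≤ n - 1`. -/
def oddSum (l : ℕ → ℤ) : ℤ := ∑ h ∈ (Finset.Icc 1 (n - 1)).filter Odd, l h

variable [NeZero n]

/-- The representation of degree one with `a ↦ (x)`, `b ↦ (y)`. -/
def linearRep (x y : ℂ) (hx : x * x = 1) (hy : y * y = x ^ n) :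
    QuaternionGroup n →* Matrix (Fin 1) (Fin 1) ℂ :=
  homOfGenerators (Matrix.diagonal fun _ => x) (Matrix.diagonal fun _ => y)
    (by rw [Matrix.diagonal_pow]; ext i j; fin_cases i; fin_cases j; simp [pow_mul, pow_two, hx])
    (by rw [Matrix.diagonal_pow, Matrix.diagonal_mul_diagonal]
        ext i j; fin_cases i; fin_cases j; simp [hy])
    (by rw [Matrix.diagonal_mul_diagonal, Matrix.diagonal_mul_diagonal]
        ext i j; fin_cases i; fin_cases j; simp [mul_right_comm, hx])

/-- `ψ₁ : a ↦ 1, b ↦ 1`. -/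
noncomputable def psi₁ : QuaternionGroup n →* Matrix (Fin 1) (Fin 1) ℂ :=
  linearRep n 1 1 (by simp) (by simp)

/-- `ψ₂ : a ↦ 1, b ↦ -1`. -/
noncomputable def psi₂ : QuaternionGroup n →* Matrix (Fin 1) (Fin 1) ℂ :=
  linearRep n 1 (-1) (by simp) (by simp)

/-- `ψ₃ : a ↦ -1, b ↦ ε`. -/
noncomputable def psi₃ : QuaternionGroup n →* Matrix (Fin 1) (Fin 1) ℂ :=
  linearRep n (-1) (eps n) (by simp) (eps_mul_eps n)

/-- `ψ₄ : a ↦ -1, b ↦ -ε`. -/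
noncomputable def psi₄ : QuaternionGroup n →* Matrix (Fin 1) (Fin 1) ℂ :=
  linearRep n (-1) (-eps n) (by simp) (by rw [neg_mul_neg, eps_mul_eps])

/-- `ρ_h : a ↦ diag(ω^h, ω^{-h}), b ↦ (0, 1; ω^{hn}, 0)`. -/
noncomputable def rho (h : ℕ) : QuaternionGroup n →* Matrix (Fin 2) (Fin 2) ℂ :=
  homOfGenerators (Matrix.diagonal ![omega n ^ h, (omega n ^ h)⁻¹]) !![0, 1; omega n ^ (h * n), 0]
    (by
      have e : (omega n ^ h) ^ (2 * n) = 1 := by rw [pow_right_comm, omega_pow, one_pow]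
      rw [Matrix.diagonal_pow]
      ext i j; fin_cases i <;> fin_cases j <;> simp [e])
    (by
      have e : (omega n ^ h) ^ n * (omega n ^ h) ^ n = 1 := by
        rw [← pow_add, ← two_mul, pow_right_comm, omega_pow, one_pow]
      have e' := eq_inv_of_mul_eq_one_left e
      rw [Matrix.diagonal_pow]
      ext i j; fin_cases i <;> fin_cases j <;> simp [Matrix.mul_apply, Fin.sum_univ_two, pow_mul]
      exact e')
    (by
      have e : omega n ^ h ≠ 0 := pow_ne_zero _ (omega_ne_zero n)
      ext i j; fin_cases i <;> fin_cases j <;>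
        simp [Matrix.mul_apply, Matrix.diagonal, e]
      field_simp)

/-- `l₂(λ₂ - λ₁) + l₃(λ₃ - λ₁) + l₄(λ₄ - λ₁) + ∑_{h=1}^{n-1} l_h (μ_h - λ₁) = 0`, where `λ_i` and
`μ_h` are the eigenvalues of `Cay(T_{4n}, S)` that correspond to `ψ_i` and `ρ_h`. -/
def IsEigenvalueRelation (S : Finset (QuaternionGroup n)) (l₂ l₃ l₄ : ℤ) (l : ℕ → ℤ) : Prop :=
  (l₂ : ℂ) * (cayleyEigenvalue S (psi₂ n) - cayleyEigenvalue S (psi₁ n))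
    + (l₃ : ℂ) * (cayleyEigenvalue S (psi₃ n) - cayleyEigenvalue S (psi₁ n))
    + (l₄ : ℂ) * (cayleyEigenvalue S (psi₄ n) - cayleyEigenvalue S (psi₁ n))
    + ∑ h ∈ Finset.Icc 1 (n - 1),
        (l h : ℂ) * (cayleyEigenvalue S (rho n h) - cayleyEigenvalue S (psi₁ n)) = 0

end Dicyclic

/-!
By Schur's lemma `∑ s ∈ S, ρ s` is scalar for irreducible `ρ`, so the translates `x ↦ tr ρ(g⁻¹x)` of
the irreducible characters are eigenvectors of the Cayley graph; they span all functions. Pairing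
with them shows that `H(t_k) e_u` converges to `α e_u + β e_{uz}`, where the central involution `z`
acts by a sign in each irreducible representation, if and only if the phases `exp(i t_k θ)` tend to
`α + β` for the eigenvalues `θ` of the positive representations and to `α - β` for those of the
negative ones. So fractional revival asks for two distinct limits on the circle. Relative to the
phase of the trivial representation these limits are `1` and some `ζ ≠ 1`, and by Kronecker's
theorem they are attained if and only if `ζ ^ m = 1` for each `m` that arises as the sum of the
coefficients over the negative representations in an integer relation between the differences of
eigenvalues. These `m` form a subgroup of `ℤ`, which is annihilated by some `ζ ≠ 1` exactly when it
does not contain `±1`.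

That `v` must be `u a ^ n` follows from the automorphisms `x ↦ g x h` of the graph: those that fix
`u` have to fix `v`, so that `u⁻¹v` lies in the centre `{1, a ^ n}`.
-/

section Kronecker

open MeasureTheory

/-- Integration against a finite measure, as a functional on the continuous functions. -/
noncomputable def integralCLM {X : Type*} [TopologicalSpace X] [CompactSpace X] [MeasurableSpace X]
    [BorelSpace X] (μ : Measure X) [IsFiniteMeasure μ] : C(X, ℂ) →L[ℂ] ℂ :=
  have hint : ∀ f : C(X, ℂ), Integrable f μ := fun f =>
    f.continuous.integrable_of_hasCompactSupport (.of_compactSpace f)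
  LinearMap.mkContinuous
    { toFun f := ∫ x, f x ∂μ
      map_add' f g := integral_add (hint f) (hint g)
      map_smul' c f := integral_const_mul c f }
    (μ.real Set.univ)
    fun f => (norm_integral_le_of_norm_le_const (.of_forall f.norm_coe_le_norm)).trans_eq
      (mul_comm _ _)

theorem ext_of_integral_eq_of_span_closure_eq_top {X : Type*} [TopologicalSpace X] [CompactSpace X]
    [HasOuterApproxClosed X] [MeasurableSpace X] [BorelSpace X] {μ ν : Measure X}
    [IsFiniteMeasure μ] [IsFiniteMeasure ν] {s : Set C(X, ℂ)}
    (hs : (Submodule.span ℂ s).topologicalClosure = ⊤)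
    (h : ∀ f ∈ s, ∫ x, f x ∂μ = ∫ x, f x ∂ν) : μ = ν := by
  have hclm : integralCLM μ = integralCLM ν :=
    ContinuousLinearMap.ext_on (Submodule.dense_iff_topologicalClosure_eq_top.mpr hs) h
  refine ext_of_forall_integral_eq_of_IsFiniteMeasure fun f => Complex.ofReal_injective ?_
  have hf : ∫ x, (f x : ℂ) ∂μ = ∫ x, (f x : ℂ) ∂ν :=
    DFunLike.congr_fun hclm ⟨fun x => (f x : ℂ), by fun_prop⟩
  simpa only [integral_complex_ofReal] using hf

theorem integral_addSubgroup_add_left_eq {A : Type*} [AddGroup A]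
    {χ : A → ℂ} (hχ : ∀ x y, χ (x + y) = χ x * χ y) (K : AddSubgroup A)
    [MeasurableSpace K] [MeasurableAdd K] (μ : Measure K) [μ.IsAddLeftInvariant] {w : A}
    (hw : (∀ k ∈ K, χ k = 1) → χ w = 1) :
    ∫ k : K, χ (w + k) ∂μ = ∫ k : K, χ k ∂μ := by
  by_cases hK : ∀ k ∈ K, χ k = 1
  · simp only [hχ, hw hK, one_mul]
  · push Not at hK
    obtain ⟨k₀, hk₀, hne⟩ := hK
    have hinv : χ k₀ * ∫ k : K, χ k ∂μ = ∫ k : K, χ k ∂μ := by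
      rw [← integral_const_mul]
      simpa only [AddSubgroup.coe_add, hχ] using
        integral_add_left_eq_self (μ := μ) (fun k : K => χ k) ⟨k₀, hk₀⟩
    simp only [hχ, integral_const_mul, eq_zero_of_mul_eq_self_left hne hinv, mul_zero]

/-- A Haar measure of `K` and its translate by `w` have the same integrals against the characters in
`s`, hence agree; as they live on `K` and `w + K`, these cosets meet. -/
theorem mem_of_forall_eq_one_of_isClosed {A : Type*} [AddGroup A] [TopologicalSpace A]
    [IsTopologicalAddGroup A] [CompactSpace A] [HasOuterApproxClosed A] [MeasurableSpace A]
    [BorelSpace A] {s : Set C(A, ℂ)} (hs : (Submodule.span ℂ s).topologicalClosure = ⊤)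
    (hmul : ∀ χ ∈ s, ∀ x y, χ (x + y) = χ x * χ y) {K : AddSubgroup A} (hK : IsClosed (K : Set A))
    {w : A} (hw : ∀ χ ∈ s, (∀ k ∈ K, χ k = 1) → χ w = 1) : w ∈ K := by
  have : CompactSpace K := isCompact_iff_compactSpace.mp hK.isCompact
  let μ : Measure K := Measure.addHaar
  have hcoe : Measurable ((↑) : K → A) := measurable_subtype_coe
  have hshift : Measurable fun k : K => w + k :=
    (continuous_const.add continuous_subtype_val).measurable
  have hmap : μ.map (fun k : K => w + k) = μ.map (↑) := by
    refine ext_of_integral_eq_of_span_closure_eq_top hs fun χ hχ => ?_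
    rw [integral_map hshift.aemeasurable χ.continuous.aestronglyMeasurable,
      integral_map hcoe.aemeasurable χ.continuous.aestronglyMeasurable]
    exact integral_addSubgroup_add_left_eq (hmul χ hχ) K μ (hw χ hχ)
  by_contra hwK
  have hdisj : (fun k : K => w + k) ⁻¹' K = ∅ := by
    ext k
    simp [K.add_mem_cancel_right k.2, hwK]
  refine IsOpen.measure_ne_zero μ isOpen_univ Set.univ_nonempty ?_
  calc μ Set.univ = μ.map (↑) (K : Set A) := by
        rw [Measure.map_apply hcoe hK.measurableSet, ← Subtype.coe_preimage_self]
        rfl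
    _ = μ.map (fun k : K => w + k) K := by rw [hmap]
    _ = 0 := by rw [Measure.map_apply hshift hK.measurableSet, hdisj, measure_empty]

variable {ι : Type*} [Fintype ι]

theorem mFourier_apply_eq_prod_toCircle_zpow (l : ι → ℤ) (w : UnitAddTorus ι) :
    UnitAddTorus.mFourier l w = (∏ i, AddCircle.toCircle (w i) ^ l i : Circle) := by
  simp only [UnitAddTorus.mFourier, ContinuousMap.coe_mk, fourier_apply,
    AddCircle.toCircle_zsmul]
  exact (map_prod Circle.coeHom (fun i => (w i).toCircle ^ l i) _).symm

theorem prod_exp_mul_zpow (θ : ι → ℝ) (l : ι → ℤ) (t : ℝ) :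
    ∏ i, Circle.exp (t * θ i) ^ l i = Circle.exp (t * ∑ i, l i * θ i) := by
  simp only [Finset.mul_sum, ← Circle.exp_intCast_mul, mul_left_comm _ t]
  exact ((congrArg Additive.toMul (map_sum Circle.expHom _ _)).trans (toMul_sum _ _)).symm

theorem eq_zero_of_forall_exp_mul_eq_one {c : ℝ} (h : ∀ t : ℝ, Circle.exp (t * c) = 1) : c = 0 := by
  by_contra hc
  have := h (Real.pi / c)
  rw [div_mul_cancel₀ _ hc] at this
  have : (-1 : ℂ) = 1 := by simpa using Circle.ext_iff.mp this
  norm_num at this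

theorem prod_zpow_eq_one_of_tendsto_exp_mul {θ : ι → ℝ} {z : ι → Circle} {t : ℕ → ℝ}
    (h : ∀ i, Tendsto (fun k => Circle.exp (t k * θ i)) atTop (𝓝 (z i))) {l : ι → ℤ}
    (hl : ∑ i, l i * θ i = 0) : ∏ i, z i ^ l i = 1 := by
  have hlim := tendsto_finsetProd Finset.univ fun i _ => (h i).zpow (l i)
  simp only [prod_exp_mul_zpow, hl, mul_zero, Circle.exp_zero] at hlim
  exact tendsto_nhds_unique hlim tendsto_const_nhds

/-- Kronecker's theorem on simultaneous approximation. -/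
theorem exists_tendsto_exp_mul_iff {θ : ι → ℝ} {z : ι → Circle} :
    (∃ t : ℕ → ℝ, ∀ i, Tendsto (fun k => Circle.exp (t k * θ i)) atTop (𝓝 (z i))) ↔
      ∀ l : ι → ℤ, ∑ i, l i * θ i = 0 → ∏ i, z i ^ l i = 1 := by
  refine ⟨fun ⟨t, ht⟩ l hl => prod_zpow_eq_one_of_tendsto_exp_mul ht hl, fun h => ?_⟩
  let line : ℝ →+ UnitAddTorus ι :=
    AddMonoidHom.mk' (fun s i => ((s * θ i : ℝ) : UnitAddCircle)) fun s s' => by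
      ext i
      simp [add_mul]
  let w : UnitAddTorus ι := fun i => (AddCircle.homeomorphCircle one_ne_zero).symm (z i)
  have hw : ∀ i, (w i).toCircle = z i := fun i => by
    rw [← AddCircle.homeomorphCircle_apply one_ne_zero]
    exact Homeomorph.apply_symm_apply _ _
  have hline : ∀ s i, (line s i).toCircle = Circle.exp (2 * Real.pi * s * θ i) := fun s i => by
    simp [line, AddCircle.toCircle_apply_mk, mul_assoc]
  have hmem : w ∈ line.range.topologicalClosure := by
    refine mem_of_forall_eq_one_of_isClosed UnitAddTorus.span_mFourier_closure_eq_top ?_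
      line.range.isClosed_topologicalClosure ?_
    · rintro _ ⟨l, rfl⟩ x y
      simp [mFourier_apply_eq_prod_toCircle_zpow, AddCircle.toCircle_add, mul_zpow,
        Finset.prod_mul_distrib]
    · rintro _ ⟨l, rfl⟩ hl
      rw [mFourier_apply_eq_prod_toCircle_zpow]
      simp only [hw]
      rw [h l, Circle.coe_one]
      refine eq_zero_of_forall_exp_mul_eq_one fun t => ?_
      have := hl _ (line.range.le_topologicalClosure ⟨t / (2 * Real.pi), rfl⟩)
      rwa [mFourier_apply_eq_prod_toCircle_zpow, ← Circle.coe_one, Circle.coe_inj,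
        Fintype.prod_congr _ _ fun i => congrArg (· ^ l i) (hline _ i),
        mul_div_cancel₀ _ Real.two_pi_pos.ne', prod_exp_mul_zpow] at this
  obtain ⟨x, hx, hlim⟩ := mem_closure_iff_seq_limit.mp hmem
  choose s hs using hx
  refine ⟨fun k => 2 * Real.pi * s k, fun i => ?_⟩
  have := (AddCircle.continuous_toCircle.tendsto _).comp (tendsto_pi_nhds.mp hlim i)
  simpa only [hw, ← hs, Function.comp_def, hline] using this

end Kronecker

section Phases

theorem exists_ne_one_and_forall_zpow_eq_one_iff {L : AddSubgroup ℤ} :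
    (∃ ζ : Circle, ζ ≠ 1 ∧ ∀ m ∈ L, ζ ^ m = 1) ↔ ∀ m ∈ L, ¬IsUnit m := by
  constructor
  · rintro ⟨ζ, hζ, h⟩ m hm hunit
    have := h m hm
    rcases Int.isUnit_iff.mp hunit with rfl | rfl <;> exact hζ (by simpa using this)
  · intro h
    obtain ⟨a, rfl⟩ := Int.subgroup_cyclic L
    rw [← AddSubgroup.zmultiples_eq_closure] at h ⊢
    have ha : a.natAbs ≠ 1 :=
      Int.isUnit_iff_natAbs_eq.not.mp (h a (AddSubgroup.mem_zmultiples a))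
    obtain ⟨p, hp, hpa⟩ := Nat.exists_prime_and_dvd ha
    have : Fact p.Prime := ⟨hp⟩
    refine ⟨ZMod.toCircle (1 : ZMod p), ?_, fun m hm => ?_⟩
    · rw [Ne, ← AddChar.map_zero_eq_one (ZMod.toCircle (N := p)), ZMod.injective_toCircle.eq_iff]
      exact one_ne_zero
    · have hm0 : (m : ZMod p) = 0 := (ZMod.intCast_zmod_eq_zero_iff_dvd m p).mpr
        ((Int.natCast_dvd.mpr hpa).trans (Int.mem_zmultiples_iff.mp hm))
      rw [← AddChar.map_zsmul_eq_zpow, zsmul_one, hm0, AddChar.map_zero_eq_one]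

variable {ι : Type*}

theorem prod_zpow_eq_zpow_sum {M : Type*} [CommGroup M] (s : Finset ι) (f : ι → ℤ) (x : M) :
    ∏ i ∈ s, x ^ f i = x ^ ∑ i ∈ s, f i := by
  induction s using Finset.cons_induction with
  | empty => simp
  | cons i s hi ih => rw [Finset.prod_cons, Finset.sum_cons, zpow_add, ih]

variable [DecidableEq ι] {θ : ι → ℝ} {O : Finset ι} {i₀ : ι}

/-- By compactness of the circle the common factor `exp (i t θ i₀)` has a limit along a
subsequence, so that only the phases relative to it matter. -/
theorem exists_tendsto_phases_iff_relative (hi₀ : i₀ ∉ O) :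
    (∃ (t : ℕ → ℝ) (p q : Circle), p ≠ q ∧ ∀ i,
        Tendsto (fun k => Circle.exp (t k * θ i)) atTop (𝓝 (if i ∈ O then q else p))) ↔
      ∃ ζ : Circle, ζ ≠ 1 ∧ ∃ t : ℕ → ℝ, ∀ i,
        Tendsto (fun k => Circle.exp (t k * (θ i - θ i₀))) atTop
          (𝓝 (if i ∈ O then ζ else 1)) := by
  constructor
  · rintro ⟨t, p, q, hpq, h⟩
    refine ⟨q / p, div_ne_one.mpr hpq.symm, t, fun i => ?_⟩
    simpa only [← Circle.exp_sub, ← mul_sub, if_neg hi₀, ite_div, div_self'] using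
      (h i).div' (h i₀)
  · rintro ⟨ζ, hζ, t, h⟩
    obtain ⟨p, φ, hφ, hp⟩ := CompactSpace.tendsto_subseq fun k => Circle.exp (t k * θ i₀)
    refine ⟨t ∘ φ, p, p * ζ, (mul_ne_left.mpr hζ).symm, fun i => ?_⟩
    simpa only [Function.comp_def, ← Circle.exp_add, ← mul_add, add_sub_cancel, mul_ite, mul_one]
      using hp.mul ((h i).comp hφ.tendsto_atTop)

variable [Fintype ι]

theorem exists_tendsto_phases_iff (hi₀ : i₀ ∉ O) :
    (∃ (t : ℕ → ℝ) (p q : Circle), p ≠ q ∧ ∀ i,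
        Tendsto (fun k => Circle.exp (t k * θ i)) atTop (𝓝 (if i ∈ O then q else p))) ↔
      ∀ l : ι → ℤ, ∑ i, l i * (θ i - θ i₀) = 0 → ¬IsUnit (∑ i ∈ O, l i) := by
  let relation : (ι → ℤ) →+ ℝ :=
    AddMonoidHom.mk' (fun l => ∑ i, l i * (θ i - θ i₀)) fun l m => by
      simp [add_mul, Finset.sum_add_distrib]
  let sumO : (ι → ℤ) →+ ℤ :=
    AddMonoidHom.mk' (fun l => ∑ i ∈ O, l i) fun l m => by simp [Finset.sum_add_distrib]
  calc _ ↔ ∃ ζ : Circle, ζ ≠ 1 ∧ ∀ m ∈ relation.ker.map sumO, ζ ^ m = 1 := by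
        rw [exists_tendsto_phases_iff_relative hi₀]
        simp [exists_tendsto_exp_mul_iff, relation, sumO, ite_pow, Finset.prod_ite_mem,
          prod_zpow_eq_zpow_sum, AddMonoidHom.mem_ker]
    _ ↔ ∀ m ∈ relation.ker.map sumO, ¬IsUnit m := exists_ne_one_and_forall_zpow_eq_one_iff
    _ ↔ _ := by simp [relation, sumO, AddMonoidHom.mem_ker]

end Phases

section Matrices

open Matrix

variable {V : Type*} [Fintype V]

open scoped Matrix.Norms.Operator in
theorem exp_mulVec_of_mulVec_eq_smul [DecidableEq V] {M : Matrix V V ℂ} {f : V → ℂ} {θ : ℂ}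
    (h : M *ᵥ f = θ • f) : NormedSpace.exp M *ᵥ f = Complex.exp θ • f := by
  have hpow : ∀ k : ℕ, M ^ k *ᵥ f = θ ^ k • f := by
    intro k
    induction k with
    | zero => simp
    | succ k ih => rw [pow_succ, ← mulVec_mulVec, h, mulVec_smul, ih, smul_smul, pow_succ']
  have hM := (NormedSpace.exp_series_hasSum_exp' (𝕂 := ℂ) M).map
    (AddMonoidHom.mk' (fun N : Matrix V V ℂ => N *ᵥ f) fun A B => add_mulVec A B f)
    (continuous_id.matrix_mulVec continuous_const)
  have hθ := (NormedSpace.exp_series_hasSum_exp' (𝕂 := ℂ) θ).smul_const f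
  rw [← Complex.exp_eq_exp_ℂ] at hθ
  refine hM.unique (hθ.congr_fun fun k => ?_)
  simp [smul_mulVec, hpow, smul_smul]

theorem conj_eq_self_of_mulVec_eq_smul {M : Matrix V V ℂ} (hM : M.IsHermitian) {f : V → ℂ} {θ : ℂ}
    (h : M *ᵥ f = θ • f) (hf : f ≠ 0) : (starRingEnd ℂ) θ = θ := by
  classical
  refine (isSymmetric_toEuclideanLin_iff.mpr hM).conj_eigenvalue_eq_self
    (Module.End.hasEigenvalue_of_hasEigenvector (x := WithLp.toLp 2 f) ⟨?_, ?_⟩)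
  · rw [Module.End.mem_eigenspace_iff]
    simp [h]
  · simpa using hf

theorem tendsto_iff_forall_dotProduct_of_span_eq_top {R X : Type*} [CommRing R] [TopologicalSpace R]
    [IsTopologicalRing R] {F : Set (V → R)} (hF : Submodule.span R F = ⊤) {w : X → V → R}
    {l : Filter X} {y : V → R} :
    Tendsto w l (𝓝 y) ↔ ∀ f ∈ F, Tendsto (fun k => f ⬝ᵥ w k) l (𝓝 (f ⬝ᵥ y)) := by
  classical
  constructor
  · intro h f _
    have hcont : Continuous fun w : V → R => f ⬝ᵥ w := by fun_prop
    exact (hcont.tendsto y).comp h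
  · intro h
    have hall : ∀ f ∈ Submodule.span R F, Tendsto (fun k => f ⬝ᵥ w k) l (𝓝 (f ⬝ᵥ y)) := by
      intro f hf
      induction hf using Submodule.span_induction with
      | mem f hf => exact h f hf
      | zero => simpa using tendsto_const_nhds
      | add f g _ _ hf hg => simpa only [add_dotProduct] using hf.add hg
      | smul c f _ hf => simpa only [smul_dotProduct, smul_eq_mul] using hf.const_mul c
    rw [hF] at hall
    exact tendsto_pi_nhds.mpr fun x => by simpa using hall (Pi.single x 1) trivial

end Matrices

section Graphs

open Matrix

variable {V : Type*} [Fintype V] [DecidableEq V] {Γ : SimpleGraph V} [DecidableRel Γ.Adj] {u v : V}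

theorem transitionMatrix_isSymm (Γ : SimpleGraph V) [DecidableRel Γ.Adj] (t : ℝ) :
    (transitionMatrix Γ t).IsSymm :=
  ((SimpleGraph.isSymm_adjMatrix Γ).smul _).exp

theorem dotProduct_transitionMatrix_mulVec_single {f : V → ℂ} {θ : ℝ}
    (h : Γ.adjMatrix ℂ *ᵥ f = (θ : ℂ) • f) (t : ℝ) (u : V) :
    f ⬝ᵥ transitionMatrix Γ t *ᵥ Pi.single u 1 = Circle.exp (t * θ) * f u := by
  have hsmul : ((Complex.I * (t : ℂ)) • Γ.adjMatrix ℂ) *ᵥ f =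
      (((t * θ : ℝ) : ℂ) * Complex.I) • f := by
    rw [smul_mulVec, h, smul_smul]
    push_cast
    ring_nf
  rw [dotProduct_mulVec, ← mulVec_transpose, (transitionMatrix_isSymm Γ t).eq, transitionMatrix,
    exp_mulVec_of_mulVec_eq_smul hsmul, Circle.coe_exp]
  simp

open scoped Matrix.Norms.Operator in
theorem transitionMatrix_apply_iso (φ : Γ ≃g Γ) (t : ℝ) (x y : V) :
    transitionMatrix Γ t (φ x) (φ y) = transitionMatrix Γ t x y := by
  have hreindex : reindexAlgEquiv ℂ ℂ φ.toEquiv (transitionMatrix Γ t) = transitionMatrix Γ t := by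
    have hc : Continuous (reindexAlgEquiv ℂ ℂ φ.toEquiv) := continuous_id.matrix_reindex _ _
    have hexp := NormedSpace.map_exp (reindexAlgEquiv ℂ ℂ φ.toEquiv) hc
      ((Complex.I * (t : ℂ)) • Γ.adjMatrix ℂ)
    rwa [map_smul, show reindexAlgEquiv ℂ ℂ φ.toEquiv (Γ.adjMatrix ℂ) = Γ.adjMatrix ℂ from
      SimpleGraph.Iso.reindex_adjMatrix ℂ φ] at hexp
  conv_lhs => rw [← hreindex]
  exact congrArg₂ (transitionMatrix Γ t) (φ.symm_apply_apply x) (φ.symm_apply_apply y)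

theorem AdmitsPGFR.apply_eq_of_apply_eq (h : AdmitsPGFR Γ u v) {φ : Γ ≃g Γ} (hφ : φ u = u) :
    φ v = v := by
  obtain ⟨huv, t, α, β, -, hβ, hlim⟩ := h
  have hcoord : ∀ x, Tendsto (fun k => transitionMatrix Γ (t k) x u) atTop
      (𝓝 ((α • Pi.single u (1 : ℂ) + β • Pi.single v (1 : ℂ) : V → ℂ) x)) := fun x => by
    simpa using tendsto_pi_nhds.mp hlim x
  have hinv : ∀ k, transitionMatrix Γ (t k) (φ v) u = transitionMatrix Γ (t k) v u := fun k => by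
    simpa only [hφ] using transitionMatrix_apply_iso φ (t k) v u
  have heq := tendsto_nhds_unique (hcoord v) (by simpa only [hinv] using hcoord (φ v))
  have hne : φ v ≠ u := fun e => huv (φ.injective (hφ.trans e.symm))
  by_contra hv
  exact hβ (by simpa [Pi.single_apply, huv.symm, hne, hv] using heq)

/-- The sets `F i` split `ℂ ^ V` so as to exhibit `u` and `v` as strongly cospectral vertices: the
members of `F i` are eigenvectors of the adjacency matrix for the eigenvalue `θ i`, they span
`ℂ ^ V`, some member of `F i` does not vanish at `u`, and every member takes opposite values at `u`
and `v` if `i ∈ O`, and equal values otherwise. The `θ i` need not be distinct. -/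
structure IsCospectralSplitting {ι : Type*} (Γ : SimpleGraph V) [DecidableRel Γ.Adj] (u v : V)
    (θ : ι → ℝ) (O : Finset ι) [DecidablePred (· ∈ O)] (F : ι → Set (V → ℂ)) : Prop where
  mulVec_eq_smul : ∀ i, ∀ f ∈ F i, Γ.adjMatrix ℂ *ᵥ f = (θ i : ℂ) • f
  span_eq_top : Submodule.span ℂ (⋃ i, F i) = ⊤
  exists_apply_ne_zero : ∀ i, ∃ f ∈ F i, f u ≠ 0
  apply_eq : ∀ i, ∀ f ∈ F i, f v = if i ∈ O then -f u else f u

namespace IsCospectralSplitting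

variable {ι : Type*} [DecidableEq ι] {θ : ι → ℝ} {O : Finset ι} {F : ι → Set (V → ℂ)} {i₀ : ι}

theorem tendsto_transitionMatrix_iff (hF : IsCospectralSplitting Γ u v θ O F) {t : ℕ → ℝ}
    {α β : ℂ} :
    Tendsto (fun k => transitionMatrix Γ (t k) *ᵥ Pi.single u 1) atTop
        (𝓝 (α • Pi.single u (1 : ℂ) + β • Pi.single v (1 : ℂ))) ↔
      ∀ i, Tendsto (fun k => (Circle.exp (t k * θ i) : ℂ)) atTop
        (𝓝 (if i ∈ O then α - β else α + β)) := by
  have hdot : ∀ i, ∀ f ∈ F i, f ⬝ᵥ (α • Pi.single u (1 : ℂ) + β • Pi.single v (1 : ℂ))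
      = (if i ∈ O then α - β else α + β) * f u := by
    intro i f hf
    simp only [dotProduct_add, dotProduct_smul, dotProduct_single, hF.apply_eq i f hf, smul_eq_mul]
    split_ifs <;> ring
  rw [tendsto_iff_forall_dotProduct_of_span_eq_top hF.span_eq_top]
  constructor
  · intro h i
    obtain ⟨f, hf, hfu⟩ := hF.exists_apply_ne_zero i
    have hlim := h f (Set.mem_iUnion_of_mem i hf)
    simp only [dotProduct_transitionMatrix_mulVec_single (hF.mulVec_eq_smul i f hf),
      hdot i f hf] at hlim
    simpa [hfu] using hlim.mul_const (f u)⁻¹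
  · intro h f hf
    obtain ⟨i, hf⟩ := Set.mem_iUnion.mp hf
    simp only [dotProduct_transitionMatrix_mulVec_single (hF.mulVec_eq_smul i f hf), hdot i f hf]
    exact (h i).mul_const (f u)

theorem admitsPGFR_iff_exists_tendsto_phases (hF : IsCospectralSplitting Γ u v θ O F)
    (huv : u ≠ v) (hi₀ : i₀ ∉ O) :
    AdmitsPGFR Γ u v ↔ ∃ (t : ℕ → ℝ) (p q : Circle), p ≠ q ∧ ∀ i,
      Tendsto (fun k => Circle.exp (t k * θ i)) atTop (𝓝 (if i ∈ O then q else p)) := by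
  have hcoe : ∀ (x : ℕ → Circle) (p q : Circle) (i : ι),
      Tendsto x atTop (𝓝 (if i ∈ O then q else p)) ↔
        Tendsto (fun k => (x k : ℂ)) atTop (𝓝 (if i ∈ O then (q : ℂ) else p)) := by
    intro x p q i
    refine Topology.IsInducing.subtypeVal.tendsto_nhds_iff.trans ?_
    split_ifs <;> rfl
  simp only [AdmitsPGFR, hF.tendsto_transitionMatrix_iff, huv, ne_eq, not_false_eq_true, true_and,
    hcoe]
  have hparallelogram := parallelogram_law_with_norm ℝ (E := ℂ)
  constructor
  · rintro ⟨t, α, β, hαβ, hβ, h⟩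
    have hp : ‖α + β‖ = 1 := by
      have hnorm := (h i₀).norm
      simp only [Circle.norm_coe, if_neg hi₀] at hnorm
      exact tendsto_nhds_unique hnorm tendsto_const_nhds
    have hq : ‖α - β‖ = 1 := by
      have := hparallelogram α β
      rw [hp] at this
      exact (pow_eq_one_iff_of_nonneg (norm_nonneg _) two_ne_zero).mp (by linarith)
    refine ⟨t, ⟨α + β, mem_sphere_zero_iff_norm.mpr hp⟩, ⟨α - β, mem_sphere_zero_iff_norm.mpr hq⟩,
      fun hpq => hβ ?_, h⟩
    have : α + β = α - β := congrArg ((↑) : Circle → ℂ) hpq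
    linear_combination this / 2
  · rintro ⟨t, p, q, hpq, h⟩
    refine ⟨t, (p + q) / 2, (p - q) / 2, ?_, ?_, ?_⟩
    · have := hparallelogram p q
      simp only [Circle.norm_coe] at this
      rw [norm_div, norm_div, Complex.norm_two]
      linarith
    · exact div_ne_zero (sub_ne_zero.mpr (Circle.coe_injective.ne hpq)) two_ne_zero
    · rwa [← sub_div, ← add_div, add_sub_sub_cancel, add_add_sub_cancel, add_self_div_two,
        add_self_div_two]

theorem admitsPGFR_iff [Fintype ι] (hF : IsCospectralSplitting Γ u v θ O F)
    (huv : u ≠ v) (hi₀ : i₀ ∉ O) :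
    AdmitsPGFR Γ u v ↔
      ∀ l : ι → ℤ, ∑ i, l i * (θ i - θ i₀) = 0 → ¬IsUnit (∑ i ∈ O, l i) := by
  rw [hF.admitsPGFR_iff_exists_tendsto_phases huv hi₀, exists_tendsto_phases_iff hi₀]

end IsCospectralSplitting

end Graphs

section CayleyGraphs

open Matrix

variable {G : Type*} [Group G] {S : Finset G}

theorem cayleyGraph_adj_iff (hone : 1 ∉ S) (hinv : ∀ s ∈ S, s⁻¹ ∈ S) {g g' : G} :
    (cayleyGraph S).Adj g g' ↔ g' * g⁻¹ ∈ S := by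
  have hrel : ∀ x y : G, (∃ s ∈ S, y = s * x) ↔ y * x⁻¹ ∈ S := by simp [← mul_inv_eq_iff_eq_mul]
  rw [cayleyGraph, SimpleGraph.fromRel_adj, hrel, hrel]
  constructor
  · rintro ⟨-, h | h⟩
    · exact h
    · simpa using hinv _ h
  · intro h
    exact ⟨by rintro rfl; exact hone (by simpa using h), Or.inl h⟩

/-- The automorphism `x ↦ g x h` of a Cayley graph with conjugation-invariant connection set. -/
def cayleyGraphIso (hone : 1 ∉ S) (hinv : ∀ s ∈ S, s⁻¹ ∈ S)
    (hconj : ∀ g : G, ∀ s ∈ S, g * s * g⁻¹ ∈ S) (g h : G) : cayleyGraph S ≃g cayleyGraph S where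
  toEquiv := (Equiv.mulLeft g).trans (Equiv.mulRight h)
  map_rel_iff' := by
    intro x y
    have hmul : g * y * h * (g * x * h)⁻¹ = g * (y * x⁻¹) * g⁻¹ := by group
    simp only [cayleyGraph_adj_iff hone hinv, Equiv.trans_apply, Equiv.coe_mulLeft,
      Equiv.coe_mulRight, hmul]
    exact ⟨fun hS => by simpa [mul_assoc] using hconj g⁻¹ _ hS, hconj g _⟩

theorem commute_map_sum_of_conj_mem {R : Type*} [Semiring R]
    (hconj : ∀ g : G, ∀ s ∈ S, g * s * g⁻¹ ∈ S) (ρ : G →* R) (g : G) :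
    Commute (ρ g) (∑ s ∈ S, ρ s) := by
  rw [commute_iff_eq, Finset.mul_sum, Finset.sum_mul]
  refine Finset.sum_bij' (fun s _ => g * s * g⁻¹) (fun s _ => g⁻¹ * s * g) (hconj g)
    (fun s hs => by simpa using hconj g⁻¹ s hs) (fun s _ => by group) (fun s _ => by group) ?_
  intro s _
  simp only [← map_mul, inv_mul_cancel_right]

/-- The conclusion of Schur's lemma for a matrix representation: only scalar matrices commute with
all its values. -/
def HasScalarCommutant {d : ℕ} (ρ : G →* Matrix (Fin d) (Fin d) ℂ) : Prop :=
  ∀ M : Matrix (Fin d) (Fin d) ℂ, (∀ g, Commute (ρ g) M) → ∃ c : ℂ, M = c • 1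

theorem HasScalarCommutant.sum_eq_cayleyEigenvalue_smul_one {d : ℕ}
    {ρ : G →* Matrix (Fin d) (Fin d) ℂ} (hρ : HasScalarCommutant ρ)
    (hconj : ∀ g : G, ∀ s ∈ S, g * s * g⁻¹ ∈ S) :
    ∑ s ∈ S, ρ s = cayleyEigenvalue S ρ • 1 := by
  rcases eq_or_ne d 0 with rfl | hd
  · exact Subsingleton.elim _ _
  obtain ⟨c, hc⟩ := hρ _ (commute_map_sum_of_conj_mem hconj ρ)
  have hd' : (d : ℂ) ≠ 0 := Nat.cast_ne_zero.mpr hd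
  have hcS : cayleyEigenvalue S ρ = c := by
    rw [cayleyEigenvalue, ← trace_sum, hc, trace_smul, trace_one, Fintype.card_fin, smul_eq_mul]
    field_simp
  rw [hc, hcS]

/-- The left translates `x ↦ tr ρ(g⁻¹x)` of the character of a matrix representation. -/
def translatedCharacters {d : ℕ} (ρ : G →* Matrix (Fin d) (Fin d) ℂ) : Set (G → ℂ) :=
  Set.range fun g x => (ρ (g⁻¹ * x)).trace

section Adjacency

variable [Fintype G] [DecidableEq G]

theorem AdmitsPGFR.inv_mul_mem_center (hone : 1 ∉ S) (hinv : ∀ s ∈ S, s⁻¹ ∈ S)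
    (hconj : ∀ g : G, ∀ s ∈ S, g * s * g⁻¹ ∈ S) {u v : G}
    (h : AdmitsPGFR (cayleyGraph S) u v) : u⁻¹ * v ∈ Subgroup.center G := by
  refine Subgroup.mem_center_iff.mpr fun g => ?_
  have hu : cayleyGraphIso hone hinv hconj (u * g * u⁻¹) g⁻¹ u = u :=
    show u * g * u⁻¹ * u * g⁻¹ = u by group
  have hv : u * g * u⁻¹ * v * g⁻¹ = v := h.apply_eq_of_apply_eq hu
  calc g * (u⁻¹ * v) = u⁻¹ * (u * g * u⁻¹ * v * g⁻¹) * g := by group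
    _ = u⁻¹ * v * g := by rw [hv]

theorem adjMatrix_cayleyGraph_mulVec_apply (hone : 1 ∉ S) (hinv : ∀ s ∈ S, s⁻¹ ∈ S) (f : G → ℂ)
    (g : G) : ((cayleyGraph S).adjMatrix ℂ *ᵥ f) g = ∑ s ∈ S, f (s * g) := by
  simp only [mulVec, dotProduct, SimpleGraph.adjMatrix_apply, cayleyGraph_adj_iff hone hinv,
    ite_mul, one_mul, zero_mul]
  rw [← Finset.sum_filter]
  refine Finset.sum_bij' (fun x _ => x * g⁻¹) (fun s _ => s * g) ?_ ?_ ?_ ?_ ?_ <;> simp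

theorem HasScalarCommutant.adjMatrix_mulVec_eq_smul {d : ℕ}
    {ρ : G →* Matrix (Fin d) (Fin d) ℂ} (hρ : HasScalarCommutant ρ) (hone : 1 ∉ S)
    (hinv : ∀ s ∈ S, s⁻¹ ∈ S) (hconj : ∀ g : G, ∀ s ∈ S, g * s * g⁻¹ ∈ S) {f : G → ℂ}
    (hf : f ∈ translatedCharacters ρ) :
    (cayleyGraph S).adjMatrix ℂ *ᵥ f = cayleyEigenvalue S ρ • f := by
  obtain ⟨g, rfl⟩ := hf
  ext x
  calc ((cayleyGraph S).adjMatrix ℂ *ᵥ fun x => (ρ (g⁻¹ * x)).trace) x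
      = ∑ s ∈ S, (ρ g⁻¹ * ρ s * ρ x).trace := by
        simp only [adjMatrix_cayleyGraph_mulVec_apply hone hinv, map_mul, mul_assoc]
    _ = (ρ g⁻¹ * (∑ s ∈ S, ρ s) * ρ x).trace := by
        rw [← trace_sum, ← Finset.sum_mul, ← Finset.mul_sum]
    _ = cayleyEigenvalue S ρ * (ρ (g⁻¹ * x)).trace := by
        rw [hρ.sum_eq_cayleyEigenvalue_smul_one hconj]
        simp

end Adjacency

theorem HasScalarCommutant.ofReal_re_cayleyEigenvalue [Finite G] {d : ℕ}
    {ρ : G →* Matrix (Fin d) (Fin d) ℂ} (hρ : HasScalarCommutant ρ) (hd : d ≠ 0) (hone : 1 ∉ S)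
    (hinv : ∀ s ∈ S, s⁻¹ ∈ S) (hconj : ∀ g : G, ∀ s ∈ S, g * s * g⁻¹ ∈ S) :
    ((cayleyEigenvalue S ρ).re : ℂ) = cayleyEigenvalue S ρ := by
  classical
  have := Fintype.ofFinite G
  have hcharacter : (fun x => (ρ (1⁻¹ * x)).trace) ≠ 0 := fun h => by
    simpa [hd] using congrFun h 1
  exact Complex.conj_eq_iff_re.mp <| conj_eq_self_of_mulVec_eq_smul
    (SimpleGraph.isHermitian_adjMatrix ℂ _) (hρ.adjMatrix_mulVec_eq_smul hone hinv hconj ⟨1, rfl⟩)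
    hcharacter

variable [Fintype G] [DecidableEq G]

/-- A complete family of irreducible complex representations of a finite group, in matrix form.
Irreducibility is encoded by Schur's lemma, and completeness by the decomposition of the character
of the regular representation. -/
structure IsCompleteFamily {ι : Type*} [Fintype ι] {d : ι → ℕ}
    (ρ : ∀ i, G →* Matrix (Fin (d i)) (Fin (d i)) ℂ) : Prop where
  degree_ne_zero : ∀ i, d i ≠ 0
  hasScalarCommutant : ∀ i, HasScalarCommutant (ρ i)
  sum_degree_mul_trace : ∀ x,
    ∑ i, (d i : ℂ) * (ρ i x).trace = if x = 1 then (Fintype.card G : ℂ) else 0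

namespace IsCompleteFamily

variable {ι : Type*} [Fintype ι] {d : ι → ℕ} {ρ : ∀ i, G →* Matrix (Fin (d i)) (Fin (d i)) ℂ}

theorem span_iUnion_translatedCharacters (hρ : IsCompleteFamily ρ) :
    Submodule.span ℂ (⋃ i, translatedCharacters (ρ i)) = ⊤ := by
  rw [eq_top_iff, ← (Pi.basisFun ℂ G).span_eq, Submodule.span_le]
  rintro _ ⟨g, rfl⟩
  have hsingle : Pi.basisFun ℂ G g = (Fintype.card G : ℂ)⁻¹ •
      ∑ i, (d i : ℂ) • fun x => (ρ i (g⁻¹ * x)).trace := by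
    ext x
    simp only [Pi.smul_apply, Finset.sum_apply, smul_eq_mul, hρ.sum_degree_mul_trace,
      inv_mul_eq_one]
    simp [Pi.single_apply, eq_comm]
  rw [hsingle]
  exact Submodule.smul_mem _ _ <| Submodule.sum_mem _ fun i _ => Submodule.smul_mem _ _ <|
    Submodule.subset_span <| Set.mem_iUnion_of_mem i ⟨g, rfl⟩

variable [DecidableEq ι] {z : G} {O : Finset ι} {i₀ : ι}

theorem isCospectralSplitting (hρ : IsCompleteFamily ρ) (hone : 1 ∉ S) (hinv : ∀ s ∈ S, s⁻¹ ∈ S)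
    (hconj : ∀ g : G, ∀ s ∈ S, g * s * g⁻¹ ∈ S)
    (hz : ∀ i, ρ i z = (if i ∈ O then -1 else 1 : ℂ) • 1) (u : G) :
    IsCospectralSplitting (cayleyGraph S) u (u * z) (fun i => (cayleyEigenvalue S (ρ i)).re) O
      (fun i => translatedCharacters (ρ i)) where
  mulVec_eq_smul i f hf := by
    rw [(hρ.hasScalarCommutant i).ofReal_re_cayleyEigenvalue (hρ.degree_ne_zero i) hone hinv hconj]
    exact (hρ.hasScalarCommutant i).adjMatrix_mulVec_eq_smul hone hinv hconj hf
  span_eq_top := hρ.span_iUnion_translatedCharacters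
  exists_apply_ne_zero i :=
    ⟨fun x => (ρ i (u⁻¹ * x)).trace, ⟨u, rfl⟩, by simp [hρ.degree_ne_zero i]⟩
  apply_eq := by
    rintro i _ ⟨g, rfl⟩
    simp only [← mul_assoc, map_mul _ _ z, hz i]
    split_ifs <;> simp

theorem admitsPGFR_mul_iff (hρ : IsCompleteFamily ρ) (hone : 1 ∉ S) (hinv : ∀ s ∈ S, s⁻¹ ∈ S)
    (hconj : ∀ g : G, ∀ s ∈ S, g * s * g⁻¹ ∈ S) (hz₁ : z ≠ 1)
    (hz : ∀ i, ρ i z = (if i ∈ O then -1 else 1 : ℂ) • 1) (hi₀ : i₀ ∉ O) (u : G) :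
    AdmitsPGFR (cayleyGraph S) u (u * z) ↔
      ∀ l : ι → ℤ, ∑ i, (l i : ℂ) * (cayleyEigenvalue S (ρ i) - cayleyEigenvalue S (ρ i₀)) = 0 →
        ¬IsUnit (∑ i ∈ O, l i) := by
  have hreal : ∀ i, ((cayleyEigenvalue S (ρ i)).re : ℂ) = cayleyEigenvalue S (ρ i) := fun i =>
    (hρ.hasScalarCommutant i).ofReal_re_cayleyEigenvalue (hρ.degree_ne_zero i) hone hinv hconj
  rw [(hρ.isCospectralSplitting hone hinv hconj hz u).admitsPGFR_iff (by simpa using hz₁) hi₀]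
  refine forall_congr' fun l => imp_congr_left ?_
  rw [← Complex.ofReal_eq_zero]
  push_cast
  simp only [hreal]

end IsCompleteFamily

end CayleyGraphs

section ScalarCommutant

open Matrix

theorem hasScalarCommutant_of_degree_one {G : Type*} [Group G]
    (ρ : G →* Matrix (Fin 1) (Fin 1) ℂ) : HasScalarCommutant ρ := fun M _ =>
  ⟨M 0 0, by ext i j; fin_cases i; fin_cases j; simp⟩

theorem apply_eq_zero_of_commute_diagonal {m K : Type*} [Fintype m] [DecidableEq m] [CommRing K]
    [IsDomain K] {w : m → K} (hw : Function.Injective w) {M : Matrix m m K}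
    (h : Commute (diagonal w) M) {i j : m} (hij : i ≠ j) : M i j = 0 := by
  have hentry : w i * M i j = M i j * w j := by
    simpa only [diagonal_mul, mul_diagonal] using congrFun₂ h.eq i j
  refine (mul_eq_zero.mp ?_).resolve_left (sub_ne_zero.mpr (hw.ne hij))
  linear_combination hentry

end ScalarCommutant

theorem sum_pow_add_inv_pow {K : Type*} [Field K] {n : ℕ} [NeZero n] {η : K}
    (hη : η ^ (2 * n) = 1) :
    ∑ h ∈ Finset.Icc 1 (n - 1), (η ^ h + (η ^ h)⁻¹) + 1 + η ^ n =
      ∑ h ∈ Finset.range (2 * n), η ^ h := by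
  obtain ⟨m, rfl⟩ := Nat.exists_eq_succ_of_ne_zero (NeZero.ne n)
  have hinv : ∀ i ∈ Finset.range m, (η ^ (i + 1))⁻¹ = η ^ (m + 1 + (m - 1 - i + 1)) := by
    intro i hi
    rw [Finset.mem_range] at hi
    refine inv_eq_of_mul_eq_one_right ?_
    rw [← pow_add, ← hη]
    congr 1
    omega
  have hIcc : ∀ f : ℕ → K, ∑ h ∈ Finset.Icc 1 m, f h = ∑ i ∈ Finset.range m, f (i + 1) := by
    intro f
    rw [Finset.range_eq_Ico, Finset.sum_Ico_add', zero_add, Finset.Ico_add_one_right_eq_Icc]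
  rw [Nat.succ_sub_one, hIcc, Finset.sum_add_distrib, Finset.sum_congr rfl hinv,
    Finset.sum_range_reflect fun i => η ^ (m + 1 + (i + 1)), two_mul, Finset.sum_range_add,
    Finset.sum_range_succ', Finset.sum_range_succ' fun i => η ^ (m + 1 + i)]
  simp only [pow_zero, add_zero, Nat.succ_eq_add_one]
  ring

theorem sum_pow_add_inv_pow_eq_ite {K : Type*} [Field K] [DecidableEq K] {n : ℕ} [NeZero n] {η : K}
    (hη : η ^ (2 * n) = 1) :
    ∑ h ∈ Finset.Icc 1 (n - 1), (η ^ h + (η ^ h)⁻¹) + 1 + η ^ n =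
      if η = 1 then (2 * n : K) else 0 := by
  rw [sum_pow_add_inv_pow hη]
  split_ifs with h
  · simp [h]
  · rw [geom_sum_eq h, hη, sub_self, zero_div]

namespace Dicyclic

open QuaternionGroup

section Group

variable {n : ℕ}

theorem eq_a_natCast_of_mem_center (hn : 2 ≤ n) {g : QuaternionGroup n}
    (hg : g ∈ Subgroup.center (QuaternionGroup n)) (hg₁ : g ≠ 1) : g = a n := by
  have : NeZero n := ⟨by omega⟩
  rw [Subgroup.mem_center_iff] at hg
  rcases g with k | k
  · obtain ⟨m, hm, rfl⟩ : ∃ m < 2 * n, (m : ZMod (2 * n)) = k :=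
      ⟨k.val, ZMod.val_lt k, ZMod.natCast_zmod_val k⟩
    have hcomm : (m : ZMod (2 * n)) = -m := by simpa using hg (xa 0)
    have hdvd : 2 * n ∣ 2 * m := by
      rw [← ZMod.natCast_eq_zero_iff]
      push_cast
      linear_combination hcomm
    obtain ⟨c, rfl⟩ := Nat.dvd_of_mul_dvd_mul_left two_pos hdvd
    have hc : c < 2 := by
      rw [mul_comm 2] at hm
      exact lt_of_mul_lt_mul_left hm (Nat.zero_le n)
    interval_cases c
    · exact absurd (by simp) hg₁
    · rw [mul_one]
  · have hcomm := hg (a 1)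
    simp only [xa_mul_a, a_mul_xa, xa.injEq] at hcomm
    have hdvd : 2 * n ∣ 2 := by
      rw [← ZMod.natCast_eq_zero_iff]
      push_cast
      linear_combination -hcomm
    have := Nat.le_of_dvd two_pos hdvd
    omega

variable [NeZero n]

theorem a_natCast_ne_one : (a n : QuaternionGroup n) ≠ 1 := by
  rw [one_def, Ne, a.injEq, ZMod.natCast_eq_zero_iff]
  exact Nat.not_dvd_of_pos_of_lt (NeZero.pos n) (by have := NeZero.pos n; omega)

theorem homOfGenerators_a_natCast {M : Type*} [Monoid M] {A B : M} (h₁ : A ^ (2 * n) = 1)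
    (h₂ : B * B = A ^ n) (h₃ : A * B * A = B) (k : ℕ) :
    homOfGenerators A B h₁ h₂ h₃ (a k) = A ^ k :=
  pow_val_natCast h₁ k

theorem homOfGenerators_xa_natCast {M : Type*} [Monoid M] {A B : M} (h₁ : A ^ (2 * n) = 1)
    (h₂ : B * B = A ^ n) (h₃ : A * B * A = B) (k : ℕ) :
    homOfGenerators A B h₁ h₂ h₃ (xa k) = B * A ^ k :=
  congrArg (B * ·) (pow_val_natCast h₁ k)

end Group

section Values

open Matrix

variable {n : ℕ} [NeZero n]

theorem isPrimitiveRoot_omega : IsPrimitiveRoot (omega n) (2 * n) := by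
  convert Complex.isPrimitiveRoot_exp (2 * n) (NeZero.ne _) using 1
  have hn : (n : ℂ) ≠ 0 := Nat.cast_ne_zero.mpr (NeZero.ne n)
  rw [omega]
  congr 1
  push_cast
  field_simp

theorem omega_pow_self : omega n ^ n = -1 := by
  have hn : (n : ℂ) ≠ 0 := Nat.cast_ne_zero.mpr (NeZero.ne n)
  rw [omega, ← Complex.exp_nat_mul, mul_div_cancel₀ _ hn, Complex.exp_pi_mul_I]

section Linear

variable {x y : ℂ} (hx : x * x = 1) (hy : y * y = x ^ n) (k : ℕ)

theorem linearRep_a_natCast : linearRep n x y hx hy (a k) = x ^ k • 1 := by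
  rw [linearRep, homOfGenerators_a_natCast, diagonal_pow, smul_one_eq_diagonal]
  rfl

theorem trace_linearRep_a_natCast : (linearRep n x y hx hy (a k)).trace = x ^ k := by
  simp [linearRep_a_natCast]

theorem trace_linearRep_xa_natCast : (linearRep n x y hx hy (xa k)).trace = y * x ^ k := by
  rw [linearRep, homOfGenerators_xa_natCast, diagonal_pow, diagonal_mul_diagonal]
  simp

end Linear

variable (h k : ℕ)

theorem rho_a_natCast :
    rho n h (a k) = diagonal ![omega n ^ (h * k), (omega n ^ (h * k))⁻¹] := by
  rw [rho, homOfGenerators_a_natCast, diagonal_pow]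
  congr 1
  ext i
  fin_cases i <;> simp [pow_mul]

theorem rho_xa_natCast : rho n h (xa k) =
    !![0, (omega n ^ (h * k))⁻¹; omega n ^ (h * n) * omega n ^ (h * k), 0] := by
  rw [rho, homOfGenerators_xa_natCast, diagonal_pow]
  ext i j
  fin_cases i <;> fin_cases j <;> simp [mul_apply, pow_mul]

theorem trace_rho_a_natCast :
    (rho n h (a k)).trace = omega n ^ (h * k) + (omega n ^ (h * k))⁻¹ := by
  simp [rho_a_natCast]

theorem trace_rho_xa_natCast : (rho n h (xa k)).trace = 0 := by
  simp [rho_xa_natCast, trace_fin_two]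

theorem rho_a_natCast_self : rho n h (a n) = (-1 : ℂ) ^ h • 1 := by
  rw [rho_a_natCast, mul_comm, pow_mul, omega_pow_self, ← inv_pow, inv_neg_one,
    smul_one_eq_diagonal]
  congr 1
  ext i
  fin_cases i <;> rfl

variable {h}

theorem hasScalarCommutant_rho (h₀ : 0 < h) (hn : h < n) : HasScalarCommutant (rho n h) := by
  intro M hM
  have hω : omega n ^ h ≠ 0 := pow_ne_zero _ (omega_ne_zero n)
  have hne : omega n ^ h ≠ (omega n ^ h)⁻¹ := by
    rw [Ne, ← mul_eq_one_iff_eq_inv₀ hω, ← pow_add]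
    exact isPrimitiveRoot_omega.pow_ne_one_of_pos_of_lt (by omega) (by omega)
  have hinj : Function.Injective ![omega n ^ h, (omega n ^ h)⁻¹] := by
    intro i j
    fin_cases i <;> fin_cases j <;> simp [hne, hne.symm]
  have ha : Commute (diagonal ![omega n ^ h, (omega n ^ h)⁻¹]) M := by
    simpa only [rho_a_natCast, mul_one] using hM (a (1 : ℕ))
  have hb : M 1 1 = M 0 0 := by
    have hcomm := congrFun₂ (hM (xa (0 : ℕ))).eq 0 1
    rw [rho_xa_natCast] at hcomm
    simpa [mul_apply] using hcomm
  refine ⟨M 0 0, ?_⟩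
  ext i j
  fin_cases i <;> fin_cases j <;>
    simp [hb, apply_eq_zero_of_commute_diagonal hinj ha]

end Values

section Family

variable (n : ℕ)

/-- Indices of the irreducible representations of the dicyclic group: `Sum.inl i` stands for
`ψ_{i+1}`, and `Sum.inr h` for `ρ_h`. -/
abbrev RepIndex : Type := Fin 4 ⊕ Finset.Icc 1 (n - 1)

/-- The degree of an irreducible representation of the dicyclic group. -/
def repDegree : RepIndex n → ℕ
  | .inl _ => 1
  | .inr _ => 2

/-- The irreducible representations of the dicyclic group as a single family. -/
noncomputable def irrep [NeZero n] : ∀ i : RepIndex n,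
    QuaternionGroup n →* Matrix (Fin (repDegree n i)) (Fin (repDegree n i)) ℂ
  | .inl i => ![psi₁ n, psi₂ n, psi₃ n, psi₄ n] i
  | .inr h => rho n h

/-- The irreducible representations in which the central involution `a ^ n` acts by `-1`. -/
def negativeReps : Finset (RepIndex n) :=
  (if Odd n then {2, 3} else ∅ : Finset (Fin 4)).disjSum
    (Finset.univ.filter fun h => Odd (h : ℕ))

variable {n}

/-- The integers `l₁, l₂, l₃, l₄, l_1, …, l_{n-1}` of an eigenvalue relation as one family, indexed
by the irreducible representations. -/
def repCoeff (l₁ l₂ l₃ l₄ : ℤ) (l : ℕ → ℤ) : RepIndex n → ℤ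
  | .inl i => ![l₁, l₂, l₃, l₄] i
  | .inr h => l h

theorem inl_mem_negativeReps {i : Fin 4} :
    (Sum.inl i : RepIndex n) ∈ negativeReps n ↔ Odd n ∧ (i = 2 ∨ i = 3) := by
  rw [negativeReps, Finset.inl_mem_disjSum]
  split_ifs with h <;> simp [h]

theorem inr_mem_negativeReps {h : Finset.Icc 1 (n - 1)} :
    (Sum.inr h : RepIndex n) ∈ negativeReps n ↔ Odd (h : ℕ) := by
  simp [negativeReps]

theorem forall_iff_forall_repCoeff {p : (RepIndex n → ℤ) → Prop} :
    (∀ l, p l) ↔ ∀ (l₁ l₂ l₃ l₄ : ℤ) (l : ℕ → ℤ), p (repCoeff l₁ l₂ l₃ l₄ l) := by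
  refine ⟨fun hp _ _ _ _ _ => hp _, fun hp l => ?_⟩
  have hl : repCoeff (l (.inl 0)) (l (.inl 1)) (l (.inl 2)) (l (.inl 3))
      (Function.extend Subtype.val (fun h => l (.inr h)) 0) = l := by
    ext (i | h)
    · fin_cases i <;> rfl
    · exact Subtype.val_injective.extend_apply (fun h => l (.inr h)) 0 h
  exact hl ▸ hp _ _ _ _ _

theorem sum_negativeReps_repCoeff (l₁ l₂ l₃ l₄ : ℤ) (l : ℕ → ℤ) :
    ∑ i ∈ negativeReps n, repCoeff l₁ l₂ l₃ l₄ l i =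
      (if Odd n then l₃ + l₄ else 0) + oddSum n l := by
  rw [negativeReps, Finset.sum_disjSum, Finset.sum_filter, oddSum, Finset.sum_filter,
    ← Finset.sum_coe_sort (Finset.Icc 1 (n - 1))]
  congr 1
  split_ifs <;> simp [repCoeff]

variable [NeZero n]

theorem irrep_a_natCast_self (i : RepIndex n) :
    irrep n i (a n) = (if i ∈ negativeReps n then -1 else 1 : ℂ) • 1 := by
  have hpow : ∀ m : ℕ, (-1 : ℂ) ^ m = if Odd m then -1 else 1 := fun m => by
    simp only [neg_one_pow_eq_ite, ← Nat.not_even_iff_odd, ite_not]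
  have hlinear : ∀ {x y : ℂ} (hx : x * x = 1) (hy : y * y = x ^ n) {c : ℂ}, x ^ n = c →
      linearRep n x y hx hy (a n) = c • 1 := by
    rintro x y hx hy _ rfl
    exact linearRep_a_natCast hx hy n
  rcases i with i | h
  · fin_cases i
    · exact hlinear (y := 1) (by simp) (by simp) (by simp [inl_mem_negativeReps])
    · exact hlinear (y := -1) (by simp) (by simp) (by simp [inl_mem_negativeReps])
    · exact hlinear (by simp) (eps_mul_eps n) (by simp [inl_mem_negativeReps, hpow])
    · exact hlinear (by simp) (by rw [neg_mul_neg, eps_mul_eps])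
        (by simp [inl_mem_negativeReps, hpow])
  · refine (rho_a_natCast_self _).trans (congrArg (· • (1 : Matrix (Fin 2) (Fin 2) ℂ)) ?_)
    simp [inr_mem_negativeReps, hpow]

theorem hasScalarCommutant_irrep : ∀ i : RepIndex n, HasScalarCommutant (irrep n i)
  | .inl _ => hasScalarCommutant_of_degree_one _
  | .inr ⟨h, hh⟩ => by
    obtain ⟨h₁, h₂⟩ := Finset.mem_Icc.mp hh
    have hlt : h < n := by omega
    exact hasScalarCommutant_rho h₁ hlt

theorem sum_repDegree_mul_trace_irrep (x : QuaternionGroup n) :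
    ∑ i, (repDegree n i : ℂ) * (irrep n i x).trace =
      (psi₁ n x).trace + (psi₂ n x).trace + (psi₃ n x).trace + (psi₄ n x).trace +
        2 * ∑ h ∈ Finset.Icc 1 (n - 1), (rho n h x).trace := by
  rw [Fintype.sum_sum_type, Fin.sum_univ_four, Finset.mul_sum,
    ← Finset.sum_coe_sort _ fun h => 2 * (rho n h x).trace]
  simp only [repDegree, Nat.cast_one, one_mul]
  rfl

theorem sum_repDegree_mul_trace_irrep_a (k : ℕ) :
    ∑ i, (repDegree n i : ℂ) * (irrep n i (a k)).trace =
      if 2 * n ∣ k then (4 * n : ℂ) else 0 := by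
  have hη : (omega n ^ k) ^ (2 * n) = 1 := by rw [pow_right_comm, omega_pow, one_pow]
  have hhalf : (omega n ^ k) ^ n = (-1) ^ k := by rw [pow_right_comm, omega_pow_self]
  have hsum := sum_pow_add_inv_pow_eq_ite hη
  simp only [hhalf, isPrimitiveRoot_omega.pow_eq_one_iff_dvd, ← pow_mul, mul_comm k] at hsum
  simp only [sum_repDegree_mul_trace_irrep, psi₁, psi₂, psi₃, psi₄, trace_linearRep_a_natCast,
    trace_rho_a_natCast, one_pow]
  split_ifs at hsum ⊢ <;> linear_combination 2 * hsum

theorem sum_repDegree_mul_trace_irrep_xa (k : ℕ) :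
    ∑ i, (repDegree n i : ℂ) * (irrep n i (xa k)).trace = 0 := by
  rw [sum_repDegree_mul_trace_irrep]
  simp [psi₁, psi₂, psi₃, psi₄, trace_linearRep_xa_natCast, trace_rho_xa_natCast]

theorem isCompleteFamily_irrep : IsCompleteFamily (irrep n) where
  degree_ne_zero i := by rcases i with _ | _ <;> simp [repDegree]
  hasScalarCommutant := hasScalarCommutant_irrep
  sum_degree_mul_trace := by
    rintro (k | k) <;> obtain ⟨k, rfl⟩ := ZMod.natCast_zmod_surjective k
    · rw [sum_repDegree_mul_trace_irrep_a]
      simp [QuaternionGroup.card, one_def, -a_zero, ZMod.natCast_eq_zero_iff]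
    · rw [sum_repDegree_mul_trace_irrep_xa]
      simp [one_def, -a_zero]

theorem sum_mul_sub_cayleyEigenvalue_eq_zero_iff {S : Finset (QuaternionGroup n)}
    {l₁ l₂ l₃ l₄ : ℤ} {l : ℕ → ℤ} :
    ∑ i, (repCoeff l₁ l₂ l₃ l₄ l i : ℂ) *
        (cayleyEigenvalue S (irrep n i) - cayleyEigenvalue S (irrep n (.inl 0))) = 0 ↔
      IsEigenvalueRelation n S l₂ l₃ l₄ l := by
  rw [IsEigenvalueRelation, Fintype.sum_sum_type, Fin.sum_univ_four, sub_self, mul_zero, zero_add,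
    ← Finset.sum_coe_sort (Finset.Icc 1 (n - 1))]
  rfl

theorem admitsPGFR_mul_a_natCast_iff {S : Finset (QuaternionGroup n)} (hone : 1 ∉ S)
    (hinv : ∀ s ∈ S, s⁻¹ ∈ S) (hconj : ∀ g : QuaternionGroup n, ∀ s ∈ S, g * s * g⁻¹ ∈ S)
    (u : QuaternionGroup n) :
    AdmitsPGFR (cayleyGraph S) u (u * a n) ↔
      ∀ (l₂ l₃ l₄ : ℤ) (l : ℕ → ℤ), IsEigenvalueRelation n S l₂ l₃ l₄ l →
        (if Odd n then l₃ + l₄ else 0) + oddSum n l ≠ 1 ∧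
          (if Odd n then l₃ + l₄ else 0) + oddSum n l ≠ -1 := by
  have hi₀ : (.inl 0 : RepIndex n) ∉ negativeReps n := by simp [inl_mem_negativeReps]
  rw [isCompleteFamily_irrep.admitsPGFR_mul_iff hone hinv hconj a_natCast_ne_one
    irrep_a_natCast_self hi₀, forall_iff_forall_repCoeff]
  simp only [sum_mul_sub_cayleyEigenvalue_eq_zero_iff, sum_negativeReps_repCoeff, Int.isUnit_iff,
    not_or, forall_const, ne_eq]

end Family

end Dicyclic

theorem mainTheorem1 (n : ℕ) [NeZero n] (hn : 2 ≤ n) (S : Finset (QuaternionGroup n))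
    (hone : 1 ∉ S) (hinv : ∀ s ∈ S, s⁻¹ ∈ S)
    (hconj : ∀ g : QuaternionGroup n, ∀ s ∈ S, g * s * g⁻¹ ∈ S) :
    (∀ u v : QuaternionGroup n, AdmitsPGFR (cayleyGraph S) u v →
      u⁻¹ * v ∈ Subgroup.zpowers (QuaternionGroup.a 1 : QuaternionGroup n) ∧
        v = u * QuaternionGroup.a 1 ^ n) ∧
    (Odd n → ∀ u v : QuaternionGroup n, v = u * QuaternionGroup.a 1 ^ n →
      (AdmitsPGFR (cayleyGraph S) u v ↔
        ∀ (l₂ l₃ l₄ : ℤ) (l : ℕ → ℤ), Dicyclic.IsEigenvalueRelation n S l₂ l₃ l₄ l →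
          l₃ + l₄ + Dicyclic.oddSum n l ≠ 1 ∧ l₃ + l₄ + Dicyclic.oddSum n l ≠ -1)) ∧
    (Even n → ∀ u v : QuaternionGroup n, v = u * QuaternionGroup.a 1 ^ n →
      (AdmitsPGFR (cayleyGraph S) u v ↔
        ∀ (l₂ l₃ l₄ : ℤ) (l : ℕ → ℤ), Dicyclic.IsEigenvalueRelation n S l₂ l₃ l₄ l →
          Dicyclic.oddSum n l ≠ 1 ∧ Dicyclic.oddSum n l ≠ -1)) := by
  refine ⟨fun u v h => ?_, ?_, ?_⟩
  · have hne : u⁻¹ * v ≠ 1 := fun e => h.1 (inv_mul_eq_one.mp e)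
    have hv : u⁻¹ * v = QuaternionGroup.a 1 ^ n := by
      rw [QuaternionGroup.a_one_pow]
      exact Dicyclic.eq_a_natCast_of_mem_center hn (h.inv_mul_mem_center hone hinv hconj) hne
    exact ⟨hv ▸ Subgroup.npow_mem_zpowers _ n, inv_mul_eq_iff_eq_mul.mp hv⟩
  · rintro hodd u v rfl
    rw [QuaternionGroup.a_one_pow, Dicyclic.admitsPGFR_mul_a_natCast_iff hone hinv hconj]
    simp only [if_pos hodd]
  · rintro heven u v rfl
    rw [QuaternionGroup.a_one_pow, Dicyclic.admitsPGFR_mul_a_natCast_iff hone hinv hconj]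
    simp only [if_neg (Nat.not_odd_iff_even.mpr heven), zero_add]
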